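/- Let $G$ be a finite simple planar graph that contains no cycle of length $3$, $6$, $7$ or $8$. Then $G$ is DP-$3$-colorable, in the following sense. Suppose that every vertex $u$ of $G$ is given a set $L(u)\supseteq\{1,2,3\}$ of colors and that every edge $uv$ of $G$ is given a (not necessarily perfect) matching $M_{uv}$ between $L(u)$ and $L(v)$. Let $H$ be the graph whose vertices are the pairs $(u,c)$ with $u\in V(G)$ and $c\in L(u)$, where $\{u\}\times L(u)$ is a clique for every vertex $u$, the edges between $\{u\}\times L(u)$ and $\{v\}\times L(v)$ are those of $M_{uv}$ if $uv\in E(G)$, and there are no such edges if $u\ne v$ and $uv\notin E(G)$. Then $H$ has an independent set of size $|V(G)|$. -/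

import Mathlib

namespace SimpleGraph

universe u

variable {V : Type u}

/-! ### Planar graphs, via combinatorial embeddings -/

/-- The permutation of the darts (oriented edges) of `G` that reverses every dart. -/
def dartReverse (G : SimpleGraph V) : Equiv.Perm G.Dart :=
  Function.Involutive.toPerm Dart.symm Dart.symm_involutive

/-- A rotation system on `G`, i.e. a combinatorial embedding of `G` in closed oriented surfaces:
at every vertex, a cyclic order of the darts that leave this vertex. It is given as one permutation
`next` of the darts whose cycles are exactly the sets of darts with a common initial vertex. -/
structure RotationSystem (G : SimpleGraph V) where
  /-- the dart that follows a given one in the cyclic order at its initial vertex -/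
  next : Equiv.Perm G.Dart
  /-- the cycles of `next` are the stars of the vertices -/
  sameCycle_iff : ∀ d e : G.Dart, next.SameCycle d e ↔ d.fst = e.fst

namespace RotationSystem

variable {G : SimpleGraph V} (M : RotationSystem G)

/-- One step along a facial walk: go along the dart `d` from `u` to `v`, then leave `v` by the dart
that follows the reverse of `d` in the cyclic order at `v`. -/
def faceNext : Equiv.Perm G.Dart :=
  M.next * G.dartReverse

/-- The facial walks of the embedding, as cycles of `faceNext`. Each component of `G` that has an
edge lies on a surface of its own, whose faces are discs bounded by these walks. -/
def Face : Type u :=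
  Quotient (Equiv.Perm.SameCycle.setoid M.faceNext)

/-- The total Euler characteristic (vertices minus edges plus faces) of the surfaces on which the
components of `G` are embedded. An isolated vertex has no dart; it lies on a sphere of its own, with
one face, and these faces are counted by the last summand. -/
noncomputable def eulerChar : ℤ :=
  (Nat.card V : ℤ) - (Nat.card G.edgeSet : ℤ) +
    ((Nat.card M.Face : ℤ) + (Nat.card {v : V // G.IsIsolated v} : ℤ))

/-- Twice the total genus of the surfaces on which the components of `G` are embedded: the surface
of a component has Euler characteristic `2 - 2g`. For a finite graph all these genera are
nonnegative, so that the sum vanishes iff all the surfaces are spheres. -/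
noncomputable def eulerGenus : ℤ :=
  2 * (Nat.card G.ConnectedComponent : ℤ) - M.eulerChar

end RotationSystem

/-- A finite graph is planar if it has a combinatorial embedding of genus zero: every component is
embedded in the sphere (equivalently, `G` is embedded in the plane). -/
def IsPlanar (G : SimpleGraph V) : Prop :=
  ∃ M : RotationSystem G, M.eulerGenus = 0

/-! ### DP-colouring (correspondence colouring) -/

/-- A matching assignment for the list assignment `L`: for every edge `uv` of `G`, a matching
between `L u` and `L v`; `rel u v c d` says that the colours `c ∈ L u` and `d ∈ L v` are matched.
The values of `rel u v` for non-adjacent `u`, `v` play no role. -/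
structure MatchingAssignment (G : SimpleGraph V) (L : V → Set ℕ) where
  /-- the matching of the edge `uv` -/
  rel : ∀ u v : V, L u → L v → Prop
  /-- the matchings of `uv` and of `vu` are the same -/
  symm : ∀ u v : V, G.Adj u v → ∀ (c : L u) (d : L v), rel u v c d → rel v u d c
  /-- a colour at `u` has at most one partner at `v` (and vice versa, by symmetry) -/
  unique : ∀ u v : V, G.Adj u v → ∀ (c : L u) (d d' : L v), rel u v c d → rel u v c d' → d = d'

namespace MatchingAssignment

variable {G : SimpleGraph V} {L : V → Set ℕ} (A : MatchingAssignment G L)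

/-- The cover graph: its vertices are the pairs of a vertex `u` and a colour in `L u`, each list is a
clique, the edges between the lists of adjacent vertices are those of the matching, and there are no
edges between the lists of distinct non-adjacent vertices. -/
def cover : SimpleGraph (Σ u : V, L u) where
  Adj x y := (x.1 = y.1 ∧ x ≠ y) ∨ (G.Adj x.1 y.1 ∧ A.rel x.1 y.1 x.2 y.2)
  symm := ⟨by
    rintro x y (⟨h, hne⟩ | ⟨h, hr⟩)
    · exact Or.inl ⟨h.symm, hne.symm⟩
    · exact Or.inr ⟨h.symm, A.symm _ _ h _ _ hr⟩⟩
  loopless := ⟨by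
    rintro x (⟨_, hne⟩ | ⟨h, _⟩)
    · exact hne rfl
    · exact G.irrefl h⟩

/-- `G` (finite, with `n` vertices) has a colouring for the matching assignment if the cover graph
has an independent set of size `n`. -/
def HasColoring : Prop :=
  ∃ S : Finset (Σ u : V, L u), A.cover.IsNIndepSet (Nat.card V) S

end MatchingAssignment

/-- `G` is DP-`k`-colourable if it has a colouring for every matching assignment over every list
assignment with `L u ⊇ [k] = {1, …, k}` for all `u`. -/
def IsDPColorable (G : SimpleGraph V) (k : ℕ) : Prop :=
  ∀ L : V → Set ℕ, (∀ u : V, Set.Icc 1 k ⊆ L u) →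
    ∀ A : MatchingAssignment G L, A.HasColoring

end SimpleGraph

/-! By greedy colouring it suffices that every nonempty vertex set `U` contains a vertex with at
most two neighbours in `U` (`isDPColorable_of_degenerate`). Otherwise `G[U]` is planar of minimum
degree at least three without cycles of length 3, 6, 7, 8, which discharging refutes
(`not_minDegreeThree`).

Its faces have length 4, 5 or at least 8. Two short faces sharing an edge would yield a cycle of
length 6, 7 or 8, unless they are pentagons whose corners opposite to the edge coincide; that corner
then has degree at least four (`minimalPeriod_rot_opposite`). Spread V - E + F over the darts: a
dart at a vertex of degree d on a face of length l gets 1/d + 1/l - 1/2. For an edge between two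
pentagons, each of its darts passes 1/20 to the opposite corner of its pentagon. Afterwards no
vertex has positive total (`charge_rot_sum_nonpos`), whereas genus zero makes the sum positive.

Planarity of `G[U]` is handled by permutations: deleting an edge splits cycles of the rotation and
of the reversal, and a split never increases the genus (`mapGenus_swap_mul_le`). Deleted darts stay
as fixed points, so all submaps live on one type. -/

namespace Setoid

/-! ### Counting the classes of comparable partitions -/

variable {D : Type*}

/-- The setoid obtained from `s` by merging the classes of `x` and `y`. -/
def merge (s : Setoid D) (x y : D) : Setoid D where
  r a b := s a b ∨ ((s a x ∨ s a y) ∧ (s b x ∨ s b y))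
  iseqv := by
    refine ⟨fun a => Or.inl (s.refl a), ?_, ?_⟩
    · rintro a b (h | ⟨h, h'⟩)
      · exact Or.inl (s.symm h)
      · exact Or.inr ⟨h', h⟩
    · rintro a b c (h | ⟨h, h'⟩) (k | ⟨k, k'⟩)
      · exact Or.inl (s.trans h k)
      · exact Or.inr ⟨k.imp (s.trans h) (s.trans h), k'⟩
      · exact Or.inr ⟨h, h'.imp (s.trans (s.symm k)) (s.trans (s.symm k))⟩
      · exact Or.inr ⟨h, k'⟩

theorem le_merge (s : Setoid D) (x y : D) : s ≤ s.merge x y := fun _ _ h => Or.inl h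

theorem merge_rel (s : Setoid D) (x y : D) : s.merge x y x y :=
  Or.inr ⟨Or.inl (s.refl x), Or.inr (s.refl y)⟩

variable [Finite D]

theorem card_quotient_anti {r s : Setoid D} (h : r ≤ s) :
    Nat.card (Quotient s) ≤ Nat.card (Quotient r) :=
  Nat.card_le_card_of_surjective (Quotient.map' (s₁ := r) (s₂ := s) id h) <| by
    rintro ⟨a⟩
    exact ⟨Quotient.mk r a, rfl⟩

theorem card_quotient_lt {r s : Setoid D} (h : r ≤ s) {x y : D} (hr : ¬ r x y) (hs : s x y) :
    Nat.card (Quotient s) + 1 ≤ Nat.card (Quotient r) := by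
  by_contra hlt
  have hsurj : Function.Surjective (Quotient.map' (s₁ := r) (s₂ := s) id h) := by
    rintro ⟨a⟩
    exact ⟨Quotient.mk r a, rfl⟩
  have hinj := ((Nat.bijective_iff_surjective_and_card _).2
    ⟨hsurj, le_antisymm (by omega) (card_quotient_anti h)⟩).1
  have : Quotient.mk r x = Quotient.mk r y := hinj (Quotient.sound hs)
  exact hr (Quotient.exact this)

theorem card_quotient_le_of_le_merge {r s : Setoid D} {x y : D} (h : r ≤ s.merge x y) :
    Nat.card (Quotient s) ≤ Nat.card (Quotient r) + 1 := by
  classical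
  refine le_trans ?_ (Nat.add_le_add_right (card_quotient_anti h) 1)
  -- Merging identifies only the classes of `x` and `y`; with the class of `x` set apart, nothing is
  -- identified any more.
  let f : Quotient s → Option (Quotient (s.merge x y)) := fun q =>
    if q = Quotient.mk s x then none else some (Quotient.map' id (s.le_merge x y) q)
  have hf : Function.Injective f := by
    rintro ⟨a⟩ ⟨b⟩ hab
    change f (Quotient.mk s a) = f (Quotient.mk s b) at hab
    change Quotient.mk s a = Quotient.mk s b
    by_cases ha : Quotient.mk s a = Quotient.mk s x
    · by_cases hb : Quotient.mk s b = Quotient.mk s x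
      · rw [ha, hb]
      · simp [f, ha, hb] at hab
    · by_cases hb : Quotient.mk s b = Quotient.mk s x
      · simp [f, ha, hb] at hab
      · simp only [f, ha, hb, if_false, Option.some.injEq] at hab
        have ha' : ¬ s a x := fun h => ha (Quotient.sound h)
        have hb' : ¬ s b x := fun h => hb (Quotient.sound h)
        rcases (Quotient.exact hab : s.merge x y a b) with h | ⟨h, h'⟩
        · exact Quotient.sound h
        · exact Quotient.sound (s.trans (h.resolve_left ha') (s.symm (h'.resolve_left hb')))
  calc Nat.card (Quotient s) ≤ Nat.card (Option (Quotient (s.merge x y))) :=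
        Nat.card_le_card_of_injective f hf
    _ = _ := Finite.card_option

end Setoid

/-! ### Cycles of permutations and the genus of hypermaps -/

namespace Equiv.Perm

variable {D : Type*}

theorem sameCycleSetoid_le_iff {σ : Perm D} {s : Setoid D} :
    SameCycle.setoid σ ≤ s ↔ ∀ a, s a (σ a) := by
  constructor
  · intro h a
    exact h (sameCycle_apply_right.2 (SameCycle.refl σ a))
  · rintro h a b ⟨i, rfl⟩
    induction i using Int.induction_on with
    | zero => simp
    | succ i ih =>
      refine s.trans ih ?_
      rw [add_comm, zpow_add, zpow_one]
      exact h _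
    | pred i ih =>
      refine s.trans ih (s.symm ?_)
      have := h ((σ ^ (-(i : ℤ) - 1)) a)
      rwa [← mul_apply, ← zpow_one_add, show 1 + (-(i : ℤ) - 1) = -i by ring] at this

/-- The number of cycles of a permutation, fixed points included. -/
noncomputable def cycleCount (σ : Perm D) : ℕ := Nat.card (Quotient (SameCycle.setoid σ))

/-- The partition into orbits of the group generated by two permutations. -/
def connSetoid (σ τ : Perm D) : Setoid D := SameCycle.setoid σ ⊔ SameCycle.setoid τ

/-- Twice the genus of the hypermap given by two permutations. -/
noncomputable def mapGenus (σ τ : Perm D) : ℤ :=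
  2 * Nat.card (Quotient (connSetoid σ τ)) + Nat.card D -
    (cycleCount σ + cycleCount τ + cycleCount (σ * τ))

theorem connSetoid_le_iff {σ τ : Perm D} {s : Setoid D} :
    connSetoid σ τ ≤ s ↔ (∀ a, s a (σ a)) ∧ ∀ a, s a (τ a) := by
  rw [connSetoid, sup_le_iff, sameCycleSetoid_le_iff, sameCycleSetoid_le_iff]

theorem connSetoid_apply_left (σ τ : Perm D) (a : D) : connSetoid σ τ a (σ a) :=
  (connSetoid_le_iff.1 le_rfl).1 a

theorem connSetoid_apply_right (σ τ : Perm D) (a : D) : connSetoid σ τ a (τ a) :=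
  (connSetoid_le_iff.1 le_rfl).2 a

theorem sameCycleSetoid_inv (σ : Perm D) : SameCycle.setoid σ⁻¹ = SameCycle.setoid σ :=
  Setoid.ext fun _ _ => sameCycle_inv

theorem cycleCount_inv (σ : Perm D) : cycleCount σ⁻¹ = cycleCount σ := by
  rw [cycleCount, sameCycleSetoid_inv, cycleCount]

/-- Inverting the product exchanges the roles of the two permutations, which carries results on the
first over to the second. -/
theorem mapGenus_inv (σ τ : Perm D) : mapGenus τ⁻¹ σ⁻¹ = mapGenus σ τ := by
  rw [mapGenus, mapGenus, ← mul_inv_rev, cycleCount_inv, cycleCount_inv, cycleCount_inv,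
    connSetoid, connSetoid, sameCycleSetoid_inv, sameCycleSetoid_inv, sup_comm]
  ring

theorem pow_mod_apply {σ : Perm D} {x : D} {m j : ℕ} (h : (σ ^ m) x = x) :
    (σ ^ (j % m)) x = (σ ^ j) x := by
  conv_rhs => rw [← Nat.mod_add_div j m, pow_add, pow_mul, mul_apply]
  exact congrArg _ ((show Function.IsFixedPt (σ ^ m) x from h).perm_pow _).symm

variable [DecidableEq D]

theorem rel_swap_mul {σ : Perm D} {s : Setoid D} {x y : D} (hσ : ∀ a, s a (σ a)) (hxy : s x y)
    (a : D) : s a ((swap x y * σ) a) := by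
  rw [mul_apply]
  refine s.trans (hσ a) ?_
  by_cases hx : σ a = x
  · rw [hx, swap_apply_left]; exact hxy
  by_cases hy : σ a = y
  · rw [hy, swap_apply_right]; exact s.symm hxy
  rw [swap_apply_of_ne_of_ne hx hy]

theorem rel_of_rel_swap_mul {σ : Perm D} {s : Setoid D} {x y : D}
    (hσ : ∀ a, s a ((swap x y * σ) a)) (hxy : s x y) (a : D) : s a (σ a) := by
  have := rel_swap_mul hσ hxy a
  rwa [← mul_assoc, swap_mul_self, one_mul] at this

theorem swap_mul_pow_apply {σ : Perm D} {x y : D} {m : ℕ}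
    (h : ∀ i, 0 < i → i < m → (σ ^ i) x ≠ x ∧ (σ ^ i) x ≠ y) :
    ∀ i < m, ((swap x y * σ) ^ i) x = (σ ^ i) x := by
  intro i
  induction i with
  | zero => simp
  | succ i ih =>
    intro hi
    rw [pow_succ', mul_apply, ih (by omega), mul_apply, ← mul_apply σ, ← pow_succ',
      swap_apply_of_ne_of_ne (h _ (by omega) hi).1 (h _ (by omega) hi).2]

theorem swap_mul_pow_return {σ : Perm D} {x y : D} {m : ℕ} (hm : 0 < m)
    (h : ∀ i, 0 < i → i < m → (σ ^ i) x ≠ x ∧ (σ ^ i) x ≠ y) :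
    ((swap x y * σ) ^ m) x = swap x y ((σ ^ m) x) := by
  obtain ⟨i, rfl⟩ : ∃ i, m = i + 1 := ⟨m - 1, by omega⟩
  rw [pow_succ', mul_apply, swap_mul_pow_apply h i (by omega), mul_apply, ← mul_apply σ,
    ← pow_succ']

variable [Finite D]

/-- The first time at which the `σ`-orbit of `x` meets `{x, y}`. -/
theorem exists_first_return (σ : Perm D) (x y : D) : ∃ m : ℕ, 0 < m ∧
    ((σ ^ m) x = x ∨ (σ ^ m) x = y) ∧ ∀ i, 0 < i → i < m → (σ ^ i) x ≠ x ∧ (σ ^ i) x ≠ y := by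
  classical
  have hex : ∃ m : ℕ, 0 < m ∧ ((σ ^ m) x = x ∨ (σ ^ m) x = y) :=
    ⟨orderOf σ, orderOf_pos σ, Or.inl (by rw [pow_orderOf_eq_one, one_apply])⟩
  refine ⟨Nat.find hex, (Nat.find_spec hex).1, (Nat.find_spec hex).2, fun i hi him => ?_⟩
  have := Nat.find_min hex him
  tauto

/-- The orbits of `x` under both permutations agree until the first return to `{x, y}`. Here this
return is at `x`, and the swap redirects it to `y`. -/
theorem sameCycle_swap_mul {σ : Perm D} {x y : D} (hxy : ¬ σ.SameCycle x y) :
    (swap x y * σ).SameCycle x y := by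
  obtain ⟨m, hm, hor, h⟩ := exists_first_return σ x y
  have hx : (σ ^ m) x = x := hor.resolve_right fun h => hxy ⟨m, by simpa using h⟩
  exact ⟨m, by rw [zpow_natCast, swap_mul_pow_return hm h, hx, swap_apply_left]⟩

/-- The first return is now at `y`; the swap redirects it to `x`, closing the new cycle before `y`
is met. -/
theorem not_sameCycle_swap_mul {σ : Perm D} {x y : D} (hne : x ≠ y) (hxy : σ.SameCycle x y) :
    ¬ (swap x y * σ).SameCycle x y := by
  obtain ⟨m, hm, hor, h⟩ := exists_first_return σ x y
  have hy : (σ ^ m) x = y := by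
    refine hor.resolve_left fun hx => ?_
    obtain ⟨j, hj⟩ := hxy.exists_nat_pow_eq
    have hmod : (σ ^ (j % m)) x = y := by
      rw [pow_mod_apply hx, hj]
    rcases Nat.eq_zero_or_pos (j % m) with h0 | h0
    · rw [h0] at hmod; exact hne hmod
    · exact (h _ h0 (Nat.mod_lt _ hm)).2 hmod
  have hret : ((swap x y * σ) ^ m) x = x := by
    rw [swap_mul_pow_return hm h, hy, swap_apply_right]
  intro hs
  obtain ⟨j, hj⟩ := hs.exists_nat_pow_eq
  have hmod : ((swap x y * σ) ^ (j % m)) x = y := by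
    rw [pow_mod_apply hret, hj]
  rcases Nat.eq_zero_or_pos (j % m) with h0 | h0
  · rw [h0] at hmod; exact hne hmod
  · rw [swap_mul_pow_apply h _ (Nat.mod_lt _ hm)] at hmod
    exact (h _ h0 (Nat.mod_lt _ hm)).2 hmod

theorem cycleCount_swap_mul_of_sameCycle {σ : Perm D} {x y : D} (hne : x ≠ y)
    (hxy : σ.SameCycle x y) : cycleCount σ + 1 ≤ cycleCount (swap x y * σ) := by
  refine Setoid.card_quotient_lt (sameCycleSetoid_le_iff.2 ?_) (not_sameCycle_swap_mul hne hxy) hxy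
  exact rel_swap_mul (sameCycleSetoid_le_iff.1 le_rfl) hxy

theorem cycleCount_le_swap_mul (σ : Perm D) (x y : D) :
    cycleCount σ ≤ cycleCount (swap x y * σ) + 1 := by
  refine Setoid.card_quotient_le_of_le_merge (x := x) (y := y) (sameCycleSetoid_le_iff.2 ?_)
  exact rel_swap_mul (fun a => Setoid.le_merge _ x y (sameCycleSetoid_le_iff.1 le_rfl a))
    (Setoid.merge_rel _ x y)

/-- Splitting a cycle of the first permutation of a hypermap does not increase its genus. -/
theorem mapGenus_swap_mul_le {σ : Perm D} (τ : Perm D) {x y : D} (hxy : σ.SameCycle x y) :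
    mapGenus (swap x y * σ) τ ≤ mapGenus σ τ := by
  by_cases hne : x = y
  · subst hne
    simp [← Equiv.Perm.one_def]
  have h1 := cycleCount_swap_mul_of_sameCycle hne hxy
  -- If the face cycle splits as well, two cycles are gained, which pays for the one component that
  -- may be new. Otherwise two face cycles are joined; this keeps `x` and `y` connected, so no
  -- component is new, and the cycle gained in `σ` offsets the one lost.
  by_cases hφ : (σ * τ).SameCycle x y
  · have h2 := cycleCount_swap_mul_of_sameCycle hne hφ
    have h3 : Nat.card (Quotient (connSetoid (swap x y * σ) τ)) ≤
        Nat.card (Quotient (connSetoid σ τ)) + 1 := by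
      refine Setoid.card_quotient_le_of_le_merge (x := x) (y := y) (connSetoid_le_iff.2 ⟨?_, ?_⟩)
      · exact rel_of_rel_swap_mul
          (fun a => Setoid.le_merge _ x y (connSetoid_apply_left _ _ a)) (Setoid.merge_rel _ x y)
      · exact fun a => Setoid.le_merge _ x y (connSetoid_apply_right _ _ a)
    rw [mapGenus, mapGenus, mul_assoc]
    omega
  · have h2 := cycleCount_le_swap_mul (σ * τ) x y
    have h4 : connSetoid (swap x y * σ) τ x y := by
      have hle : SameCycle.setoid (swap x y * (σ * τ)) ≤ connSetoid (swap x y * σ) τ := by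
        refine sameCycleSetoid_le_iff.2 fun a => ?_
        rw [← mul_assoc, mul_apply]
        exact Setoid.trans' _ (connSetoid_apply_right _ _ a) (connSetoid_apply_left _ _ _)
      exact hle (sameCycle_swap_mul hφ)
    have h3 : Nat.card (Quotient (connSetoid (swap x y * σ) τ)) ≤
        Nat.card (Quotient (connSetoid σ τ)) := by
      refine Setoid.card_quotient_anti (connSetoid_le_iff.2 ⟨?_, connSetoid_apply_right _ _⟩)
      exact rel_of_rel_swap_mul (connSetoid_apply_left _ _) h4
    rw [mapGenus, mapGenus, mul_assoc]
    omega

/-- Splitting a cycle of the second permutation of a hypermap does not increase its genus. -/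
theorem mapGenus_mul_swap_le (σ : Perm D) {τ : Perm D} {x y : D} (hxy : τ.SameCycle x y) :
    mapGenus σ (τ * swap x y) ≤ mapGenus σ τ := by
  rw [← mapGenus_inv σ (τ * swap x y), ← mapGenus_inv σ τ, mul_inv_rev, swap_inv]
  exact mapGenus_swap_mul_le _ (sameCycle_inv.2 hxy)

end Equiv.Perm

namespace Equiv.Perm

variable {D : Type*} [DecidableEq D]

/-- The permutation obtained from `σ` by taking `a` out of its cycle. -/
def skip (σ : Perm D) (a : D) : Perm D := swap a (σ a) * σ

theorem skip_apply_self (σ : Perm D) (a : D) : skip σ a a = a := by simp [skip]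

theorem skip_apply_of_fixed {σ : Perm D} {a x : D} (hx : σ x = x) : skip σ a x = x := by
  by_cases hxa : x = a
  · rw [hxa, skip_apply_self]
  rw [skip, mul_apply, hx, swap_apply_of_ne_of_ne hxa]
  intro h
  exact hxa (σ.injective (hx.trans h))

theorem rel_skip {σ : Perm D} {s : Setoid D} (a : D) (h : ∀ x, s x (σ x)) (x : D) :
    s x (skip σ a x) :=
  rel_swap_mul h (h a) x

/-- Joining `a` to `σ a` again restores the old cycles. As `a` is now fixed, points other than `a`
can only be in the class of `σ a`. -/
theorem SameCycle.skip {σ : Perm D} {a x y : D} (h : σ.SameCycle x y) (hx : x ≠ a) (hy : y ≠ a) :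
    (skip σ a).SameCycle x y := by
  have hle : SameCycle.setoid σ ≤ (SameCycle.setoid (Perm.skip σ a)).merge a (σ a) :=
    sameCycleSetoid_le_iff.2 <| rel_of_rel_swap_mul
      (fun b => Setoid.le_merge _ _ _ (sameCycleSetoid_le_iff.1 le_rfl b)) (Setoid.merge_rel _ _ _)
  have hne : ∀ z, z ≠ a → ¬ (Perm.skip σ a).SameCycle z a := fun z hz hs =>
    hz (hs.symm.eq_of_left (skip_apply_self σ a)).symm
  rcases hle h with h | ⟨h, h'⟩
  · exact h
  · exact (h.resolve_left (hne x hx)).trans (h'.resolve_left (hne y hy)).symm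

theorem mapGenus_skip_le [Finite D] (σ τ : Perm D) (a : D) :
    mapGenus (skip σ a) τ ≤ mapGenus σ τ :=
  mapGenus_swap_mul_le τ (sameCycle_apply_right.2 (SameCycle.refl σ a))

end Equiv.Perm

/-! ### Planar submaps and deletion of edges -/

namespace SimpleGraph

open Equiv.Perm

variable {V : Type*}

/-- A combinatorial embedding of genus zero of a spanning subgraph of `G`, in which the darts of the
deleted edges are kept as fixed points of both permutations. -/
structure PlanarSubmap (G : SimpleGraph V) where
  /-- the rotation at the vertices -/
  rot : Equiv.Perm G.Dart
  /-- the reversal of the darts that are present -/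
  rev : Equiv.Perm G.Dart
  rev_eq : ∀ x, rev x = x ∨ rev x = x.symm
  fst_rot : ∀ x, (rot x).fst = x.fst
  rot_eq : ∀ x, rev x = x → rot x = x
  sameCycle : ∀ x y, rev x ≠ x → rev y ≠ y → x.fst = y.fst → rot.SameCycle x y
  -- An upper bound is all that deletion preserves directly and all that discharging needs.
  genus : mapGenus rot rev ≤ 0

variable {G : SimpleGraph V}

namespace RotationSystem

variable (M : RotationSystem G)

theorem connSetoid_of_walk {u w : V} (p : G.Walk u w) :
    ∀ x y : G.Dart, x.fst = u → y.fst = w → connSetoid M.next G.dartReverse x y := by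
  have key : ∀ x y : G.Dart, x.fst = y.fst → connSetoid M.next G.dartReverse x y := fun x y h =>
    (le_sup_left : Equiv.Perm.SameCycle.setoid M.next ≤ _) ((M.sameCycle_iff x y).2 h)
  induction p with
  | nil => exact fun x y hx hy => key x y (hx.trans hy.symm)
  | cons h p ih =>
    intro x y hx hy
    refine Setoid.trans' _ (key x ⟨(_, _), h⟩ hx) ?_
    exact Setoid.trans' _ (connSetoid_apply_right M.next G.dartReverse _) (ih _ y rfl hy)

variable [Finite V]

/-- Cycles of `next` are the non-isolated vertices and cycles of the reversal are the edges. An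
isolated vertex cancels: it adds 2 through its component and removes 2 as a vertex and a face. -/
theorem mapGenus_le : mapGenus M.next G.dartReverse ≤ M.eulerGenus := by
  classical
  have := Fintype.ofFinite V
  have hV : Nat.card V ≤ cycleCount M.next + Nat.card {v : V // G.IsIsolated v} := by
    rw [cycleCount, ← Nat.card_sum]
    let f : Quotient (SameCycle.setoid M.next) ⊕ {v : V // G.IsIsolated v} → V :=
      Sum.elim (Quotient.lift (fun x : G.Dart => x.fst) fun x y h => (M.sameCycle_iff x y).1 h)
        Subtype.val
    refine Nat.card_le_card_of_surjective f fun v => ?_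
    by_cases hv : G.IsIsolated v
    · exact ⟨Sum.inr ⟨v, hv⟩, rfl⟩
    · obtain ⟨w, hw⟩ : ∃ w, G.Adj v w := by
        by_contra! h
        exact hv h
      exact ⟨Sum.inl (Quotient.mk _ ⟨(v, w), hw⟩), rfl⟩
  have hE : Nat.card G.edgeSet ≤ cycleCount G.dartReverse := by
    let f : Quotient (SameCycle.setoid G.dartReverse) → G.edgeSet :=
      Quotient.lift (fun x : G.Dart => (⟨x.edge, x.edge_mem⟩ : G.edgeSet)) fun x y h => by
        have hle : SameCycle.setoid G.dartReverse ≤ Setoid.ker (Dart.edge : G.Dart → Sym2 V) :=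
          sameCycleSetoid_le_iff.2 fun a => (Dart.edge_symm a).symm
        exact Subtype.ext (hle h)
    refine Nat.card_le_card_of_surjective f ?_
    rintro ⟨e, he⟩
    induction e with
    | _ u v => exact ⟨Quotient.mk _ ⟨(u, v), he⟩, rfl⟩
  have hD : Nat.card G.Dart = 2 * Nat.card G.edgeSet := by
    rw [Nat.card_eq_fintype_card, G.dart_card_eq_twice_card_edges, Nat.card_eq_fintype_card,
      edgeFinset_card]
  have hC : Nat.card (Quotient (connSetoid M.next G.dartReverse)) +
      Nat.card {v : V // G.IsIsolated v} ≤ Nat.card G.ConnectedComponent := by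
    rw [← Nat.card_sum]
    have hker : connSetoid M.next G.dartReverse ≤
        Setoid.ker fun x : G.Dart => G.connectedComponentMk x.fst := by
      refine connSetoid_le_iff.2 ⟨fun x => ?_, fun x => ?_⟩
      · exact congrArg _ ((M.sameCycle_iff x _).1 (sameCycle_apply_right.2 (SameCycle.refl _ x)))
      · exact ConnectedComponent.sound x.adj.reachable
    let f : Quotient (connSetoid M.next G.dartReverse) ⊕ {v : V // G.IsIsolated v} →
        G.ConnectedComponent :=
      Sum.elim (Quotient.lift (fun x : G.Dart => G.connectedComponentMk x.fst)
        fun x y h => hker h) fun v => G.connectedComponentMk v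
    have hiso : ∀ v w : V, G.IsIsolated v → G.Reachable v w → v = w := by
      rintro v w hv ⟨p⟩
      cases p with
      | nil => rfl
      | cons h _ => exact absurd h (hv _)
    refine Nat.card_le_card_of_injective f ?_
    rintro (⟨⟨x⟩⟩ | ⟨v, hv⟩) (⟨⟨y⟩⟩ | ⟨w, hw⟩) h
    · obtain ⟨p⟩ := ConnectedComponent.exact (show G.connectedComponentMk x.fst =
        G.connectedComponentMk y.fst from h)
      exact congrArg Sum.inl (Quotient.sound (M.connSetoid_of_walk p x y rfl rfl))
    · have := hiso w x.fst hw (ConnectedComponent.exact (show G.connectedComponentMk x.fst =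
        G.connectedComponentMk w from h)).symm
      exact absurd (this ▸ x.adj) (hw _)
    · have := hiso v y.fst hv (ConnectedComponent.exact (show G.connectedComponentMk v =
        G.connectedComponentMk y.fst from h))
      exact absurd (this ▸ y.adj) (hv _)
    · have := hiso v w hv (ConnectedComponent.exact (show G.connectedComponentMk v =
        G.connectedComponentMk w from h))
      subst this
      rfl
  have hF : Nat.card M.Face = cycleCount (M.next * G.dartReverse) := rfl
  rw [mapGenus, eulerGenus, eulerChar, hF]
  omega

/-- The submap with all edges of a planar embedding. -/
def toPlanarSubmap (hM : M.eulerGenus = 0) : G.PlanarSubmap where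
  rot := M.next
  rev := G.dartReverse
  rev_eq _ := Or.inr rfl
  fst_rot x := ((M.sameCycle_iff x _).1 (sameCycle_apply_right.2 (SameCycle.refl _ x))).symm
  rot_eq x h := absurd h x.symm_ne
  sameCycle x y _ _ h := (M.sameCycle_iff x y).2 h
  genus := hM ▸ M.mapGenus_le

end RotationSystem

namespace PlanarSubmap

variable (P : G.PlanarSubmap)

theorem rev_of_ne {x : G.Dart} (h : P.rev x ≠ x) : P.rev x = x.symm :=
  (P.rev_eq x).resolve_left h

theorem rev_symm {x : G.Dart} (h : P.rev x ≠ x) : P.rev x.symm = x := by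
  rcases P.rev_eq x.symm with h' | h'
  · rw [← P.rev_of_ne h] at h'
    exact absurd (P.rev.injective h') h
  · rw [h', Dart.symm_symm]

theorem rev_symm_ne {x : G.Dart} (h : P.rev x ≠ x) : P.rev x.symm ≠ x.symm := by
  rw [P.rev_symm h]
  exact x.symm_ne.symm

variable [Finite V]

/-- Both darts are taken out of the rotation and their 2-cycle in the reversal is cut: three splits,
none of which increases the genus. -/
theorem exists_delete {a : G.Dart} (ha : P.rev a ≠ a) :
    ∃ Q : G.PlanarSubmap, ∀ x, Q.rev x = x ↔ P.rev x = x ∨ x.edge = a.edge := by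
  classical
  have := Fintype.ofFinite V
  have hrev : ∀ x, x ≠ a → x ≠ a.symm → (P.rev * Equiv.swap a a.symm) x = P.rev x := by
    intro x h h'
    rw [mul_apply, Equiv.swap_apply_of_ne_of_ne h h']
  have hrev1 : (P.rev * Equiv.swap a a.symm) a = a := by
    rw [mul_apply, Equiv.swap_apply_left, P.rev_symm ha]
  have hrev2 : (P.rev * Equiv.swap a a.symm) a.symm = a.symm := by
    rw [mul_apply, Equiv.swap_apply_right, P.rev_of_ne ha]
  have hiff : ∀ x, (P.rev * Equiv.swap a a.symm) x = x ↔ P.rev x = x ∨ x.edge = a.edge := by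
    intro x
    rw [dart_edge_eq_iff]
    by_cases h : x = a
    · simp [h, hrev1]
    by_cases h' : x = a.symm
    · simp [h', hrev2]
    rw [hrev x h h']
    simp [h, h']
  have hker : ∀ x, Setoid.ker (fun x : G.Dart => x.fst) x (P.rot x) := fun x => (P.fst_rot x).symm
  refine ⟨{ rot := skip (skip P.rot a) a.symm
            rev := P.rev * Equiv.swap a a.symm
            rev_eq := fun x => ?_
            fst_rot := fun x => (rel_skip _ (rel_skip _ hker) x).symm
            rot_eq := fun x hx => ?_
            sameCycle := fun x y hx hy hxy => ?_
            genus := ?_ }, hiff⟩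
  · by_cases h : x.edge = a.edge
    · exact Or.inl ((hiff x).2 (Or.inr h))
    · rw [dart_edge_eq_iff, not_or] at h
      rw [hrev x h.1 h.2]
      exact P.rev_eq x
  · rcases (hiff x).1 hx with h | h
    · exact skip_apply_of_fixed (skip_apply_of_fixed (P.rot_eq x h))
    · rcases (dart_edge_eq_iff x a).1 h with rfl | rfl
      · exact skip_apply_of_fixed (skip_apply_self _ _)
      · exact skip_apply_self _ _
  · rw [ne_eq, hiff, not_or, dart_edge_eq_iff, not_or] at hx hy
    exact ((P.sameCycle x y hx.1 hy.1 hxy).skip hx.2.1 hy.2.1).skip hx.2.2 hy.2.2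
  · refine (mapGenus_mul_swap_le _ ?_).trans
      ((mapGenus_skip_le _ _ _).trans ((mapGenus_skip_le _ _ _).trans P.genus))
    rw [← P.rev_of_ne ha]
    exact sameCycle_apply_right.2 (SameCycle.refl _ a)

end PlanarSubmap

theorem IsPlanar.exists_planarSubmap [Finite V] (hG : G.IsPlanar) (R : Finset (Sym2 V)) :
    ∃ P : G.PlanarSubmap, ∀ x, P.rev x = x ↔ x.edge ∈ R := by
  classical
  induction R using Finset.induction_on with
  | empty =>
    obtain ⟨M, hM⟩ := hG
    refine ⟨M.toPlanarSubmap hM, fun x => ?_⟩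
    simp only [Finset.notMem_empty, iff_false]
    exact x.symm_ne
  | insert e R _ ih =>
    obtain ⟨P, hP⟩ := ih
    by_cases h : ∃ a : G.Dart, a.edge = e ∧ P.rev a ≠ a
    · obtain ⟨a, rfl, ha⟩ := h
      obtain ⟨Q, hQ⟩ := P.exists_delete ha
      refine ⟨Q, fun x => ?_⟩
      rw [hQ, hP, Finset.mem_insert, or_comm]
    · push Not at h
      refine ⟨P, fun x => ?_⟩
      rw [Finset.mem_insert, hP]
      exact ⟨Or.inr, fun hx => hx.elim (fun hx => (hP x).1 (h x hx)) id⟩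

end SimpleGraph

/-! ### Short cycles and short facial walks -/

namespace SimpleGraph

open Equiv.Perm Function

variable {V : Type*} {G : SimpleGraph V}

theorem exists_isCycle_of_nodup {l : List V} (hne : l ≠ []) (hchain : l.IsChain G.Adj)
    (hnd : l.Nodup) (hl : 3 ≤ l.length) (hclose : G.Adj (l.getLast hne) (l.head hne)) :
    ∃ (v : V) (p : G.Walk v v), p.IsCycle ∧ p.length = l.length := by
  have hp : (Walk.ofSupport l hne hchain).IsPath := by
    rw [Walk.isPath_def, Walk.support_ofSupport]
    exact hnd
  refine ⟨_, Walk.cons hclose (Walk.ofSupport l hne hchain), ?_, ?_⟩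
  · rw [Walk.cons_isCycle_iff]
    refine ⟨hp, fun h => ?_⟩
    have := hp.length_eq_one_of_mem_edges (Sym2.eq_swap ▸ h)
    rw [Walk.length_ofSupport] at this
    omega
  · rw [Walk.length_cons, Walk.length_ofSupport]
    omega

/-- `G` has no cycle of length 3, 6, 7 or 8. -/
def NoCycles3678 (G : SimpleGraph V) : Prop :=
  ∀ (v : V) (p : G.Walk v v), p.IsCycle →
    p.length ≠ 3 ∧ p.length ≠ 6 ∧ p.length ≠ 7 ∧ p.length ≠ 8

namespace NoCycles3678

variable (hG : G.NoCycles3678)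
include hG

theorem ne_of_adj {a b c d : V} (hab : G.Adj a b) (hbc : G.Adj b c) (hcd : G.Adj c d) : a ≠ d := by
  rintro rfl
  obtain ⟨v, p, hp, hl⟩ := exists_isCycle_of_nodup (l := [a, b, c]) (by simp)
    (by simp; exact ⟨hab, hbc⟩) (by simp [hab.ne, hbc.ne, hcd.ne.symm]) (by simp)
    (by simpa using hcd)
  exact (hG v p hp).1 hl

theorem false_of_list {l : List V} (hne : l ≠ []) (hchain : l.IsChain G.Adj)
    (hnd : l.Nodup) (hl : l.length = 6 ∨ l.length = 7 ∨ l.length = 8)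
    (hclose : G.Adj (l.getLast hne) (l.head hne)) : False := by
  obtain ⟨v, p, hp, h⟩ := exists_isCycle_of_nodup hne hchain hnd (by omega) hclose
  have := hG v p hp
  omega

/-- Two squares on `ab` have a hexagon as their outer boundary; the distinctness not assumed follows
from the absence of triangles. The next two lemmas obtain a 7-cycle and an 8-cycle in the same way.
-/
theorem false_of_squares {a b c d g h : V} (hab : G.Adj a b) (hbc : G.Adj b c) (hcd : G.Adj c d)
    (hda : G.Adj d a) (hah : G.Adj a h) (hhg : G.Adj h g) (hgb : G.Adj g b) (hac : a ≠ c)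
    (hbd : b ≠ d) (hbh : b ≠ h) (hag : a ≠ g) (hcg : c ≠ g) (hdh : d ≠ h) : False := by
  have hch := hG.ne_of_adj hbc.symm hab.symm hah
  have hdg := hG.ne_of_adj hda hab hgb.symm
  refine hG.false_of_list (l := [b, c, d, a, h, g]) (by simp) ?_ ?_ (by simp) (by simpa using hgb)
  · simp [*]
  · simp [*, hbc.ne, hab.ne.symm, hcd.ne, hda.ne, hah.ne, hhg.ne, hgb.ne.symm, hac.symm]

theorem false_of_square_pentagon {a b c d f g h : V} (hab : G.Adj a b) (hbc : G.Adj b c)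
    (hcd : G.Adj c d) (hda : G.Adj d a) (hah : G.Adj a h) (hhg : G.Adj h g) (hgf : G.Adj g f)
    (hfb : G.Adj f b) (hac : a ≠ c) (hbd : b ≠ d) (hbh : b ≠ h) (haf : a ≠ f) (hcf : c ≠ f)
    (hdh : d ≠ h) : False := by
  have hch := hG.ne_of_adj hbc.symm hab.symm hah
  have hcg := hG.ne_of_adj hbc.symm hfb.symm hgf.symm
  have hdg := hG.ne_of_adj hda hah hhg
  have hdf := hG.ne_of_adj hda hab hfb.symm
  have hbg := hG.ne_of_adj hab.symm hah hhg
  have hag := hG.ne_of_adj hab hfb.symm hgf.symm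
  have hhf := hG.ne_of_adj hah.symm hab hfb.symm
  refine hG.false_of_list (l := [b, c, d, a, h, g, f]) (by simp) ?_ ?_ (by simp)
    (by simpa using hfb)
  · simp [*]
  · simp [*, hbc.ne, hab.ne.symm, hcd.ne, hda.ne, hah.ne, hhg.ne, hgf.ne, hfb.ne.symm, hac.symm]

theorem eq_of_pentagons {a b c d e f g h : V} (hab : G.Adj a b) (hbc : G.Adj b c)
    (hcd : G.Adj c d) (hde : G.Adj d e) (hea : G.Adj e a) (hah : G.Adj a h) (hhg : G.Adj h g)
    (hgf : G.Adj g f) (hfb : G.Adj f b) (hac : a ≠ c) (hbe : b ≠ e) (hbh : b ≠ h) (haf : a ≠ f)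
    (hcf : c ≠ f) (heh : e ≠ h) : d = g ∧ [c, e, h, f].Nodup := by
  have hch := hG.ne_of_adj hbc.symm hab.symm hah
  have hef := hG.ne_of_adj hea hab hfb.symm
  have hce := hG.ne_of_adj hbc.symm hab.symm hea.symm
  have hhf := hG.ne_of_adj hah.symm hab hfb.symm
  refine ⟨?_, by simp [*]⟩
  by_contra hdg
  have hcg := hG.ne_of_adj hbc.symm hfb.symm hgf.symm
  have heg := hG.ne_of_adj hea hah hhg
  have hdh := hG.ne_of_adj hde hea hah
  have hdf := hG.ne_of_adj hcd.symm hbc.symm hfb.symm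
  have hbg := hG.ne_of_adj hab.symm hah hhg
  have hag := hG.ne_of_adj hab hfb.symm hgf.symm
  have hbd := hG.ne_of_adj hab.symm hea.symm hde.symm
  have had := hG.ne_of_adj hab hbc hcd
  refine hG.false_of_list (l := [b, c, d, e, a, h, g, f]) (by simp) ?_ ?_ (by simp)
    (by simpa using hfb)
  · simp [*]
  · simp [*, hbc.ne, hab.ne.symm, hcd.ne, hde.ne, hea.ne, hah.ne, hhg.ne, hgf.ne, hfb.ne.symm,
      hac.symm, Ne.symm had]

end NoCycles3678

namespace PlanarSubmap

variable (P : G.PlanarSubmap)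

/-- One step along a facial walk. -/
def face : Equiv.Perm G.Dart := P.rot * P.rev

/-- Every vertex of the submap with an edge has degree at least three. -/
def MinDegreeThree : Prop := ∀ x, P.rev x ≠ x → P.rot x ≠ x ∧ P.rot (P.rot x) ≠ x

/-- The vertices along the facial walk that starts with the dart `x`. -/
def vert (x : G.Dart) (i : ℕ) : V := (P.face^[i] x).fst

variable {P}

theorem rev_rot_ne {x : G.Dart} (h : P.rev x ≠ x) : P.rev (P.rot x) ≠ P.rot x := fun h' =>
  h (by rw [P.rot.injective (P.rot_eq _ h')] at h'; exact h')

theorem face_apply {x : G.Dart} (h : P.rev x ≠ x) : P.face x = P.rot x.symm := by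
  rw [face, mul_apply, P.rev_of_ne h]

theorem rev_face_ne {x : G.Dart} (h : P.rev x ≠ x) : P.rev (P.face x) ≠ P.face x := by
  rw [face_apply h]
  exact rev_rot_ne (P.rev_symm_ne h)

theorem rev_iterate_ne {x : G.Dart} (h : P.rev x ≠ x) (i : ℕ) :
    P.rev (P.face^[i] x) ≠ P.face^[i] x := by
  induction i with
  | zero => exact h
  | succ i ih => rw [iterate_succ_apply']; exact rev_face_ne ih

theorem fst_face {x : G.Dart} (h : P.rev x ≠ x) : (P.face x).fst = x.snd := by
  rw [face_apply h, P.fst_rot]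
  rfl

theorem snd_iterate {x : G.Dart} (h : P.rev x ≠ x) (i : ℕ) :
    (P.face^[i] x).snd = P.vert x (i + 1) := by
  rw [vert, iterate_succ_apply', fst_face (rev_iterate_ne h i)]

theorem vert_one {x : G.Dart} (h : P.rev x ≠ x) : P.vert x 1 = x.snd := (snd_iterate h 0).symm

theorem adj_vert {x : G.Dart} (h : P.rev x ≠ x) (i : ℕ) :
    G.Adj (P.vert x i) (P.vert x (i + 1)) := by
  rw [← snd_iterate h]
  exact (P.face^[i] x).adj

theorem snd_face_ne (hP : P.MinDegreeThree) {x : G.Dart} (h : P.rev x ≠ x) :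
    (P.face x).snd ≠ x.fst := by
  intro h'
  refine (hP x.symm (P.rev_symm_ne h)).1 ?_
  rw [← face_apply h]
  exact Dart.ext _ _ (Prod.ext (fst_face h) h')

theorem vert_ne_add_two (hP : P.MinDegreeThree) {x : G.Dart} (h : P.rev x ≠ x) (i : ℕ) :
    P.vert x i ≠ P.vert x (i + 2) := by
  rw [← snd_iterate h, iterate_succ_apply']
  exact (snd_face_ne hP (rev_iterate_ne h i)).symm

theorem vert_ne_add_three (hG : G.NoCycles3678) {x : G.Dart} (h : P.rev x ≠ x) (i : ℕ) :
    P.vert x i ≠ P.vert x (i + 3) :=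
  hG.ne_of_adj (adj_vert h i) (adj_vert h (i + 1)) (adj_vert h (i + 2))

theorem vert_add_of_iterate_eq {x : G.Dart} {n : ℕ} (hn : P.face^[n] x = x) (i : ℕ) :
    P.vert x (i + n) = P.vert x i := by
  rw [vert, iterate_add_apply, hn, vert]

variable (P) in
/-- The length of the facial walk that contains a dart. -/
noncomputable def faceLen (x : G.Dart) : ℕ := minimalPeriod P.face x

theorem iterate_faceLen (x : G.Dart) : P.face^[P.faceLen x] x = x := iterate_minimalPeriod

/-- At the head of `x`, the darts towards these two vertices are the successor and the predecessor
of `x.symm` in the rotation; they differ when the degree is at least three. -/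
theorem vert_two_ne (hP : P.MinDegreeThree) {x : G.Dart} (h : P.rev x ≠ x) {n : ℕ}
    (hn : P.face^[n + 1] x.symm = x.symm) : P.vert x 2 ≠ P.vert x.symm n := by
  have hy := rev_iterate_ne (P.rev_symm_ne h) n
  rw [iterate_succ_apply'] at hn
  rw [vert, vert]
  generalize P.face^[n] x.symm = y at *
  intro h'
  have hfst : y.snd = x.snd := by rw [← fst_face hy, hn]; rfl
  refine (hP y.symm (P.rev_symm_ne hy)).2 ?_
  rw [← face_apply hy, hn, ← face_apply h]
  refine Dart.ext _ _ (Prod.ext ((fst_face h).trans hfst.symm) ?_)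
  change (P.face x).snd = y.fst
  rw [← h']
  exact snd_iterate h 1

variable [Finite V]

theorem _root_.Equiv.Perm.minimalPeriod_pos {D : Type*} [Finite D] (σ : Equiv.Perm D) (x : D) :
    0 < minimalPeriod σ x :=
  minimalPeriod_pos_of_mem_periodicPts (σ.injective.mem_periodicPts x)

instance : Finite G.Dart := Finite.of_injective _ (Dart.toProd_injective (G := G))

theorem faceLen_face (x : G.Dart) : P.faceLen (P.face x) = P.faceLen x :=
  minimalPeriod_apply (P.face.injective.mem_periodicPts x)

/-- Vertices one, two or three steps apart on a facial walk differ. On a closed walk of length 6 or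
7 this covers all pairs, so the walk would be a cycle; for length 8, vertices four steps apart may
coincide. -/
theorem faceLen_cases (hG : G.NoCycles3678) (hP : P.MinDegreeThree) {x : G.Dart}
    (h : P.rev x ≠ x) : P.faceLen x = 4 ∨ P.faceLen x = 5 ∨ 8 ≤ P.faceLen x := by
  have hpos : 0 < P.faceLen x := P.face.minimalPeriod_pos x
  have hper := vert_add_of_iterate_eq (P.iterate_faceLen x)
  have a := adj_vert h
  have n1 := fun i => (adj_vert h i).ne
  have n2 := vert_ne_add_two hP h
  have n3 := vert_ne_add_three hG h
  generalize P.faceLen x = n at *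
  by_contra! hcon
  have hn : n = 1 ∨ n = 2 ∨ n = 3 ∨ n = 6 ∨ n = 7 := by omega
  rcases hn with rfl | rfl | rfl | rfl | rfl
  · exact n1 0 (hper 0).symm
  · exact n2 0 (hper 0).symm
  · exact n3 0 (hper 0).symm
  · have m4 := hper 0 ▸ n2 4
    have m5 := hper 1 ▸ n2 5
    have := hper 0 ▸ n3 3
    have m1 := hper 0 ▸ n1 5
    refine hG.false_of_list (l := [P.vert x 0, P.vert x 1, P.vert x 2, P.vert x 3, P.vert x 4,
      P.vert x 5]) (by simp) ?_ ?_ (by simp) ?_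
    · simp [a 0, a 1, a 2, a 3, a 4]
    · simp [n1 0, n1 1, n1 2, n1 3, n1 4, n2 0, n2 1, n2 2, n2 3, n3 0, n3 1, n3 2, m4.symm,
        m5.symm, m1.symm]
    · simpa using hper 0 ▸ a 5
  · have m5 := hper 0 ▸ n2 5
    have m6 := hper 1 ▸ n2 6
    have m1 := hper 0 ▸ n1 6
    have k4 := hper 0 ▸ n3 4
    have k5 := hper 1 ▸ n3 5
    have k6 := hper 2 ▸ n3 6
    refine hG.false_of_list (l := [P.vert x 0, P.vert x 1, P.vert x 2, P.vert x 3, P.vert x 4,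
      P.vert x 5, P.vert x 6]) (by simp) ?_ ?_ (by simp) ?_
    · simp [a 0, a 1, a 2, a 3, a 4, a 5]
    · simp [n1 0, n1 1, n1 2, n1 3, n1 4, n1 5, n2 0, n2 1, n2 2, n2 3, n2 4, n3 0, n3 1, n3 2,
        n3 3, m5.symm, m6.symm, m1.symm, k4.symm, k5.symm, k6.symm]
    · simpa using hper 0 ▸ a 6

/-- Two short facial walks that share an edge are pentagons with a common vertex opposite to this
edge, and they share no further vertices. -/
theorem pentagons_of_adjacent (hG : G.NoCycles3678) (hP : P.MinDegreeThree) {x : G.Dart}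
    (h : P.rev x ≠ x) (hx : P.faceLen x < 8) (hy : P.faceLen x.symm < 8) :
    P.faceLen x = 5 ∧ P.faceLen x.symm = 5 ∧ P.vert x 3 = P.vert x.symm 3 ∧
      [P.vert x 2, P.vert x 4, P.vert x.symm 2, P.vert x.symm 4].Nodup := by
  have h' := P.rev_symm_ne h
  have hx' := faceLen_cases hG hP h
  have hy' := faceLen_cases hG hP h'
  have ix := P.iterate_faceLen x
  have iy := P.iterate_faceLen x.symm
  have p1 := vert_add_of_iterate_eq ix 1
  have q1 := vert_add_of_iterate_eq iy 1
  have px := vert_add_of_iterate_eq ix 0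
  have py := vert_add_of_iterate_eq iy 0
  have nx := vert_two_ne (n := P.faceLen x.symm - 1) hP h
    (by rwa [Nat.sub_add_cancel (by omega)])
  have ny := vert_two_ne (n := P.faceLen x - 1) hP h'
    (by rwa [Nat.sub_add_cancel (by omega), Dart.symm_symm])
  rw [Dart.symm_symm] at ny
  have w0 : P.vert x.symm 0 = P.vert x 1 := (vert_one h).symm
  have w1 : P.vert x.symm 1 = P.vert x 0 := vert_one h'
  have a := fun i => adj_vert h i
  have b := fun i => adj_vert h' i
  have d2 := fun i => vert_ne_add_two hP h i
  have e2 := fun i => vert_ne_add_two hP h' i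
  have a0 := a 0
  have b1 := w1 ▸ b 1
  have d0 := d2 0
  have d1 := d2 1
  have e0 := w0 ▸ e2 0
  have e1 := w1 ▸ e2 1
  rcases hx' with lx | lx | lx <;> rcases hy' with ly | ly | ly <;> try omega
  all_goals simp only [lx, ly, zero_add, Nat.reduceAdd, Nat.reduceSub, w0, w1]
    at px py p1 q1 nx ny a0 d0
  · exact (hG.false_of_squares a0 (a 1) (a 2) (px ▸ a 3) b1 (b 2) (py ▸ b 3) d0 d1 e0 e1 nx
      ny.symm).elim
  · exact (hG.false_of_square_pentagon a0 (a 1) (a 2) (px ▸ a 3) b1 (b 2) (b 3) (py ▸ b 4) d0 d1 e0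
      (q1 ▸ e2 4).symm nx ny.symm).elim
  -- The square now lies on the side of `x.symm`, so the ends of the edge change roles.
  · exact (hG.false_of_square_pentagon a0.symm b1 (b 2) (py ▸ b 3) (a 1) (a 2) (a 3) (px ▸ a 4) e0
      e1 d0 (p1 ▸ d2 4).symm ny nx.symm).elim
  · refine ⟨lx, ly, ?_⟩
    exact hG.eq_of_pentagons a0 (a 1) (a 2) (a 3) (px ▸ a 4) b1 (b 2) (b 3) (py ▸ b 4) d0
      (p1 ▸ d2 4).symm e0 (q1 ▸ e2 4).symm nx ny.symm

end PlanarSubmap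

end SimpleGraph

/-! ### Cycle counts as sums over points -/

namespace Equiv.Perm

open Function

variable {D : Type*} [Fintype D]

theorem card_sameCycle_eq_minimalPeriod (σ : Perm D) (a : D) [DecidablePred (σ.SameCycle a)] :
    (Finset.univ.filter (σ.SameCycle a)).card = minimalPeriod σ a := by
  classical
  have himg : Finset.univ.filter (σ.SameCycle a) =
      (Finset.range (minimalPeriod σ a)).image fun i => σ^[i] a := by
    ext b
    simp only [Finset.mem_filter, Finset.mem_univ, true_and, Finset.mem_image, Finset.mem_range]
    constructor
    · intro h
      obtain ⟨i, hi⟩ := h.exists_nat_pow_eq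
      refine ⟨i % minimalPeriod σ a, Nat.mod_lt _ (σ.minimalPeriod_pos a), ?_⟩
      rw [iterate_mod_minimalPeriod_eq, iterate_eq_pow, hi]
    · rintro ⟨i, -, rfl⟩
      exact ⟨i, by rw [iterate_eq_pow, zpow_natCast]⟩
  rw [himg, Finset.card_image_of_injOn, Finset.card_range]
  intro i hi j hj h
  exact iterate_injOn_Iio_minimalPeriod (by simpa using hi) (by simpa using hj) h

theorem minimalPeriod_eq_of_sameCycle {σ : Perm D} {a b : D} (h : σ.SameCycle a b) :
    minimalPeriod σ a = minimalPeriod σ b := by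
  classical
  rw [← card_sameCycle_eq_minimalPeriod, ← card_sameCycle_eq_minimalPeriod]
  congr 1
  ext c
  simp only [Finset.mem_filter, Finset.mem_univ, true_and]
  exact ⟨h.symm.trans, h.trans⟩

theorem sum_inv_minimalPeriod (σ : Perm D) :
    ∑ x, (1 / minimalPeriod σ x : ℚ) = cycleCount σ := by
  classical
  have := Fintype.ofFinite (Quotient (SameCycle.setoid σ))
  rw [cycleCount, Nat.card_eq_fintype_card, Fintype.card, Finset.card_eq_sum_ones,
    ← Finset.sum_fiberwise _ (Quotient.mk (SameCycle.setoid σ)), Nat.cast_sum]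
  refine Finset.sum_congr rfl fun q _ => ?_
  induction q using Quotient.inductionOn with
  | _ a =>
  have hfib : Finset.univ.filter (fun x => Quotient.mk (SameCycle.setoid σ) x = Quotient.mk _ a) =
      Finset.univ.filter (σ.SameCycle a) := by
    ext x
    simp only [Finset.mem_filter, Finset.mem_univ, true_and]
    exact ⟨fun h => (Quotient.exact h : σ.SameCycle x a).symm,
      fun h => Quotient.sound (SameCycle.symm h : σ.SameCycle x a)⟩
  rw [hfib, Finset.sum_congr rfl (g := fun _ => (1 / minimalPeriod σ a : ℚ)), Finset.sum_const,
    card_sameCycle_eq_minimalPeriod, nsmul_eq_mul, mul_one_div_cancel, Nat.cast_one]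
  · exact_mod_cast (σ.minimalPeriod_pos a).ne'
  · intro x hx
    rw [minimalPeriod_eq_of_sameCycle (Finset.mem_filter.1 hx).2]

end Equiv.Perm

/-! ### Discharging -/

namespace SimpleGraph.PlanarSubmap

open Equiv.Perm Function

variable {V : Type*} {G : SimpleGraph V} {P : G.PlanarSubmap}

variable (P) in
open Classical in
/-- The charge that moves, on either side of an edge between two pentagons, from an end of this edge
to the opposite corner of the pentagon. -/
noncomputable def transfer (x : G.Dart) : ℚ :=
  -- 1/20 = 1/4 - 1/5 is exactly the slack of a pentagon corner at a vertex of degree four.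
  if P.rev x ≠ x ∧ P.faceLen x = 5 ∧ P.faceLen x.symm = 5 then 1 / 20 else 0

variable (P) in
open Classical in
/-- The contribution of a dart to the Euler characteristic, after discharging. -/
noncomputable def charge (x : G.Dart) : ℚ :=
  -- In a pentagon, `x` is three steps after `face (face x)`, hence the opposite corner that
  -- receives its payment. The final term removes the 1 + 1 + 1 - 1 of a deleted dart.
  1 / minimalPeriod P.rot x + 1 / minimalPeriod P.rev x + 1 / P.faceLen x - 1 +
    P.transfer (P.face (P.face x)) - P.transfer x - if P.rev x = x then 2 else 0

theorem transfer_nonneg (x : G.Dart) : 0 ≤ P.transfer x := by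
  unfold transfer
  split_ifs <;> norm_num

theorem charge_of_rev_eq {x : G.Dart} (h : P.rev x = x) : P.charge x = 0 := by
  have hrot := P.rot_eq x h
  have hface : P.face x = x := by rw [face, mul_apply, h, hrot]
  have h1 := minimalPeriod_eq_one_iff_isFixedPt.2 (show IsFixedPt P.rot x from hrot)
  have h2 := minimalPeriod_eq_one_iff_isFixedPt.2 (show IsFixedPt P.rev x from h)
  have h3 := minimalPeriod_eq_one_iff_isFixedPt.2 (show IsFixedPt P.face x from hface)
  rw [charge, faceLen, h1, h2, h3, hface, hface, if_pos h]
  norm_num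

variable [Finite V]

theorem eq_or_eq_or_eq_of_minimalPeriod_rot {x y : G.Dart} (hx : P.rev x ≠ x) (hy : P.rev y ≠ y)
    (hxy : x.fst = y.fst) (hk : minimalPeriod P.rot x = 3) :
    y = x ∨ y = P.rot x ∨ y = P.rot (P.rot x) := by
  obtain ⟨i, hi⟩ := (P.sameCycle x y hx hy hxy).exists_nat_pow_eq
  have hmod := iterate_mod_minimalPeriod_eq (f := P.rot) (x := x) (n := i)
  rw [iterate_eq_pow, iterate_eq_pow, hi, hk] at hmod
  have hlt := Nat.mod_lt i (show 0 < 3 by omega)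
  generalize i % 3 = j at *
  interval_cases j
  · exact Or.inl hmod.symm
  · exact Or.inr (Or.inl hmod.symm)
  · exact Or.inr (Or.inr hmod.symm)

theorem three_le_minimalPeriod_rot (hP : P.MinDegreeThree) {x : G.Dart} (h : P.rev x ≠ x) :
    3 ≤ minimalPeriod P.rot x := by
  have hpos := P.rot.minimalPeriod_pos x
  have hper := iterate_minimalPeriod (f := P.rot) (x := x)
  by_contra! hlt
  generalize minimalPeriod P.rot x = k at *
  interval_cases k
  · exact (hP x h).1 hper
  · exact (hP x h).2 hper

/-- Both pentagons pass through this vertex, and their four neighbours of it are distinct, too many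
for degree three. -/
theorem minimalPeriod_rot_opposite (hG : G.NoCycles3678) (hP : P.MinDegreeThree) {x : G.Dart}
    (h : P.rev x ≠ x) (hx : P.faceLen x = 5) (hy : P.faceLen x.symm = 5) :
    4 ≤ minimalPeriod P.rot (P.face^[3] x) := by
  by_contra! hlt
  have h' := P.rev_symm_ne h
  have hz := rev_iterate_ne h 3
  have hk := le_antisymm (Nat.le_of_lt_succ hlt) (three_le_minimalPeriod_rot hP hz)
  obtain ⟨-, -, hopp, hnd⟩ := pentagons_of_adjacent hG hP h (by omega) (by omega)
  rw [← snd_iterate h 3, ← snd_iterate h' 3] at hnd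
  have e1 := eq_or_eq_or_eq_of_minimalPeriod_rot hz (P.rev_symm_ne (rev_iterate_ne h 2))
    (snd_iterate h 2).symm hk
  have e2 := eq_or_eq_or_eq_of_minimalPeriod_rot hz (P.rev_symm_ne (rev_iterate_ne h' 2))
    (hopp.trans (snd_iterate h' 2).symm) hk
  have e3 := eq_or_eq_or_eq_of_minimalPeriod_rot hz (rev_iterate_ne h' 3) hopp hk
  have s1 : (P.face^[2] x).symm.snd = P.vert x 2 := rfl
  have s2 : (P.face^[2] x.symm).symm.snd = P.vert x.symm 2 := rfl
  rw [← s1, ← s2] at hnd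
  generalize (P.face^[2] x).symm = u1 at *
  generalize (P.face^[2] x.symm).symm = u2 at *
  generalize P.face^[3] x = z at *
  generalize P.face^[3] x.symm = z' at *
  rcases e1 with rfl | rfl | rfl <;> rcases e2 with rfl | rfl | rfl <;>
    rcases e3 with rfl | rfl | rfl <;> simp at hnd

theorem transfer_cases (hG : G.NoCycles3678) (hP : P.MinDegreeThree) {x : G.Dart}
    (h : P.rev x ≠ x) : 8 ≤ P.faceLen x ∨ 8 ≤ P.faceLen x.symm ∨
      P.faceLen x = 5 ∧ P.faceLen x.symm = 5 ∧ P.transfer x = 1 / 20 := by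
  by_contra! hc
  obtain ⟨h5, h5', -⟩ := pentagons_of_adjacent hG hP h hc.1 hc.2.1
  exact hc.2.2 h5 h5' (if_pos ⟨h, h5, h5'⟩)

theorem transfer_face_face (hG : G.NoCycles3678) (hP : P.MinDegreeThree) (x : G.Dart) :
    P.transfer (P.face (P.face x)) = 0 ∨ P.transfer (P.face (P.face x)) = 1 / 20 ∧
      P.faceLen x = 5 ∧ 4 ≤ minimalPeriod P.rot x := by
  by_cases h : P.rev (P.face (P.face x)) ≠ P.face (P.face x) ∧
      P.faceLen (P.face (P.face x)) = 5 ∧ P.faceLen (P.face (P.face x)).symm = 5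
  · right
    have hlen : P.faceLen x = 5 := by rw [← h.2.1, faceLen_face, faceLen_face]
    refine ⟨if_pos h, hlen, ?_⟩
    have := minimalPeriod_rot_opposite hG hP h.1 h.2.1 h.2.2
    have hx := P.iterate_faceLen x
    rw [hlen] at hx
    rwa [show P.face^[3] (P.face (P.face x)) = x from hx] at this
  · exact Or.inl (if_neg h)

theorem minimalPeriod_rev {x : G.Dart} (h : P.rev x ≠ x) : minimalPeriod P.rev x = 2 := by
  have h2 : IsPeriodicPt P.rev 2 x := by
    change P.rev (P.rev x) = x
    rw [P.rev_of_ne h, P.rev_symm h]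
  have hle := h2.minimalPeriod_le (by omega)
  have hpos := P.rev.minimalPeriod_pos x
  have hne : minimalPeriod P.rev x ≠ 1 := fun h1 => h (minimalPeriod_eq_one_iff_isFixedPt.1 h1)
  omega

theorem charge_eq {x : G.Dart} (h : P.rev x ≠ x) : P.charge x =
    1 / minimalPeriod P.rot x + 1 / P.faceLen x - 1 / 2 + P.transfer (P.face (P.face x)) -
      P.transfer x := by
  rw [charge, minimalPeriod_rev h, if_neg h]
  push_cast
  ring

theorem inv_faceLen_cases (hG : G.NoCycles3678) (hP : P.MinDegreeThree) {x : G.Dart}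
    (h : P.rev x ≠ x) : (P.faceLen x = 4 ∧ (1 / P.faceLen x : ℚ) = 1 / 4) ∨
      (P.faceLen x = 5 ∧ (1 / P.faceLen x : ℚ) = 1 / 5) ∨
      (8 ≤ P.faceLen x ∧ (1 / P.faceLen x : ℚ) ≤ 1 / 8) := by
  rcases faceLen_cases hG hP h with h | h | h
  · exact Or.inl ⟨h, by rw [h]; norm_num⟩
  · exact Or.inr (Or.inl ⟨h, by rw [h]; norm_num⟩)
  · refine Or.inr (Or.inr ⟨h, one_div_le_one_div_of_le (by norm_num) ?_⟩)
    exact_mod_cast h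

/-- Before transfers the charge is at most 0, -1/20 or -1/8 on a face of length 4, 5 or at least 8;
only pentagon corners receive, and they receive 1/20. -/
theorem charge_nonpos_of_four_le (hG : G.NoCycles3678) (hP : P.MinDegreeThree) {x : G.Dart}
    (h : P.rev x ≠ x) (hk : 4 ≤ minimalPeriod P.rot x) : P.charge x ≤ 0 := by
  have hk' : (1 / minimalPeriod P.rot x : ℚ) ≤ 1 / 4 :=
    one_div_le_one_div_of_le (by norm_num) (by exact_mod_cast hk)
  have hs := transfer_nonneg (P := P) x
  rw [charge_eq h]
  rcases inv_faceLen_cases hG hP h with ⟨hl, hr⟩ | ⟨hl, hr⟩ | ⟨hl, hr⟩ <;>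
    rcases transfer_face_face hG hP x with ht | ⟨ht, hl', -⟩ <;> first | omega | linarith

theorem charge_of_three (hG : G.NoCycles3678) (hP : P.MinDegreeThree) {x : G.Dart}
    (h : P.rev x ≠ x) (hk : minimalPeriod P.rot x = 3) :
    P.charge x = 1 / P.faceLen x - 1 / 6 - P.transfer x := by
  rcases transfer_face_face hG hP x with ht | ⟨-, -, hk'⟩
  · rw [charge_eq h, hk, ht]
    push_cast
    ring
  · omega

/-- At degree three the corners hold 1/12, 1/30 or at most -1/24 on faces of length 4, 5 or at least
8. A square has two long neighbours: 1/12 - 2/24 = 0. Each edge between pentagons pays 1/20: 2/30 -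
1/24 - 1/20 < 0 and 3/30 - 3/20 < 0. A lone pentagon is outweighed by two long faces. -/
theorem charge_rot_sum_nonpos (hG : G.NoCycles3678) (hP : P.MinDegreeThree) (x : G.Dart) :
    P.charge x + P.charge (P.rot x) + P.charge (P.rot (P.rot x)) ≤ 0 := by
  by_cases h0 : P.rev x = x
  · rw [P.rot_eq x h0, P.rot_eq x h0, charge_of_rev_eq h0]
    norm_num
  have h1 := rev_rot_ne h0
  have h2 := rev_rot_ne h1
  have k1 : minimalPeriod P.rot (P.rot x) = minimalPeriod P.rot x :=
    minimalPeriod_apply (P.rot.injective.mem_periodicPts x)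
  have k2 : minimalPeriod P.rot (P.rot (P.rot x)) = minimalPeriod P.rot (P.rot x) :=
    minimalPeriod_apply (P.rot.injective.mem_periodicPts _)
  by_cases hk : 4 ≤ minimalPeriod P.rot x
  · have c0 := charge_nonpos_of_four_le hG hP h0 hk
    have c1 := charge_nonpos_of_four_le hG hP h1 (by omega)
    have c2 := charge_nonpos_of_four_le hG hP h2 (by omega)
    linarith
  have k0 : minimalPeriod P.rot x = 3 := by
    have := three_le_minimalPeriod_rot hP h0
    omega
  -- The two sides of an edge at this vertex are the faces of consecutive darts in the rotation.
  have hface : ∀ y, P.rev y ≠ y → P.faceLen y.symm = P.faceLen (P.rot y) := by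
    intro y hy
    rw [← faceLen_face, face_apply (P.rev_symm_ne hy), Dart.symm_symm]
  have h3 : P.rot (P.rot (P.rot x)) = x := by
    have := iterate_minimalPeriod (f := P.rot) (x := x)
    rwa [k0] at this
  have u0 := transfer_cases hG hP h0
  have u1 := transfer_cases hG hP h1
  have u2 := transfer_cases hG hP h2
  rw [hface _ h0] at u0
  rw [hface _ h1] at u1
  rw [hface _ h2, h3] at u2
  have s0 := transfer_nonneg (P := P) x
  have s1 := transfer_nonneg (P := P) (P.rot x)
  have s2 := transfer_nonneg (P := P) (P.rot (P.rot x))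
  rw [charge_of_three hG hP h0 k0, charge_of_three hG hP h1 (by omega),
    charge_of_three hG hP h2 (by omega)]
  have r0 := inv_faceLen_cases hG hP h0
  have r1 := inv_faceLen_cases hG hP h1
  have r2 := inv_faceLen_cases hG hP h2
  generalize (1 / P.faceLen x : ℚ) = q0 at *
  generalize (1 / P.faceLen (P.rot x) : ℚ) = q1 at *
  generalize (1 / P.faceLen (P.rot (P.rot x)) : ℚ) = q2 at *
  generalize P.faceLen x = l0 at *
  generalize P.faceLen (P.rot x) = l1 at *
  generalize P.faceLen (P.rot (P.rot x)) = l2 at *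
  rcases r0 with ⟨a0, b0⟩ | ⟨a0, b0⟩ | ⟨a0, b0⟩ <;>
    rcases r1 with ⟨a1, b1⟩ | ⟨a1, b1⟩ | ⟨a1, b1⟩ <;>
    rcases r2 with ⟨a2, b2⟩ | ⟨a2, b2⟩ | ⟨a2, b2⟩ <;>
    rcases u0 with _ | _ | ⟨_, _, _⟩ <;> try omega
  all_goals rcases u1 with _ | _ | ⟨_, _, _⟩ <;> try omega
  all_goals rcases u2 with _ | _ | ⟨_, _, _⟩ <;> first | omega | linarith

theorem card_fixed_lt_card_connSetoid {x : G.Dart} (hx : P.rev x ≠ x) :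
    Nat.card {y : G.Dart // P.rev y = y} + 1 ≤
      Nat.card (Quotient (connSetoid P.rot P.rev)) := by
  let s : Setoid G.Dart :=
    { r := fun a b => a = b ∨ (P.rev a ≠ a ∧ P.rev b ≠ b)
      iseqv := ⟨fun a => Or.inl rfl, by rintro a b (rfl | h) <;> tauto,
        by rintro a b c (rfl | h) (rfl | h') <;> tauto⟩ }
  have hle : connSetoid P.rot P.rev ≤ s := by
    refine connSetoid_le_iff.2 ⟨fun a => ?_, fun a => ?_⟩ <;> by_cases h : P.rev a = a
    · exact Or.inl (P.rot_eq a h).symm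
    · exact Or.inr ⟨h, rev_rot_ne h⟩
    · exact Or.inl h.symm
    · exact Or.inr ⟨h, fun h' => h (P.rev.injective h')⟩
  let f : Option {y : G.Dart // P.rev y = y} → Quotient (connSetoid P.rot P.rev) :=
    fun o => o.elim (Quotient.mk _ x) fun y => Quotient.mk _ y.1
  rw [← Finite.card_option]
  refine Nat.card_le_card_of_injective f ?_
  rintro (_ | ⟨y, hy⟩) (_ | ⟨z, hz⟩) h
  · rfl
  · rcases hle (Quotient.exact h) with h | h
    · exact absurd (h ▸ hz) hx
    · exact absurd hz h.2
  · rcases hle (Quotient.exact h) with h | h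
    · exact absurd (h ▸ hy) hx
    · exact absurd hy h.1
  · rcases hle (Quotient.exact h) with h | h
    · exact congrArg some (Subtype.ext h)
    · exact absurd hy h.1

/-- A planar graph without cycles of length 3, 6, 7 and 8 has no nonempty subgraph of minimum degree
at least three. -/
theorem not_minDegreeThree (hG : G.NoCycles3678) {x : G.Dart} (hx : P.rev x ≠ x) :
    ¬ P.MinDegreeThree := by
  classical
  intro hP
  have := Fintype.ofFinite G.Dart
  -- Summing over three successive rotations counts every charge three times and avoids grouping
  -- darts by vertex.
  have hnonpos : 3 * ∑ y, P.charge y ≤ 0 := by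
    have e1 : ∑ y, P.charge (P.rot y) = ∑ y, P.charge y := Equiv.sum_comp P.rot P.charge
    have e2 : ∑ y, P.charge (P.rot (P.rot y)) = ∑ y, P.charge y :=
      (Equiv.sum_comp P.rot fun y => P.charge (P.rot y)).trans e1
    calc 3 * ∑ y, P.charge y
        = ∑ y, (P.charge y + P.charge (P.rot y) + P.charge (P.rot (P.rot y))) := by
          rw [Finset.sum_add_distrib, Finset.sum_add_distrib, e1, e2]
          ring
      _ ≤ 0 := Finset.sum_nonpos fun y _ => charge_rot_sum_nonpos hG hP y
  have hsum : ∑ y, P.charge y = cycleCount P.rot + cycleCount P.rev +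
      cycleCount (P.rot * P.rev) - Nat.card G.Dart -
      2 * Nat.card {y : G.Dart // P.rev y = y} := by
    have e : ∑ y, P.transfer (P.face (P.face y)) = ∑ y, P.transfer y :=
      (Equiv.sum_comp P.face fun y => P.transfer (P.face y)).trans
        (Equiv.sum_comp P.face P.transfer)
    simp only [charge, Finset.sum_sub_distrib, Finset.sum_add_distrib, e, sum_inv_minimalPeriod,
      faceLen]
    rw [← Finset.sum_filter, Finset.sum_const, Finset.sum_const, Nat.card_eq_fintype_card,
      Nat.card_eq_fintype_card, Fintype.card_subtype, Finset.card_univ, face, nsmul_eq_mul,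
      nsmul_eq_mul]
    ring
  -- With C components and f deleted darts, the total charge is at least 2C - 2f, and C ≥ f + 1.
  have hgenus := P.genus
  have hcard := card_fixed_lt_card_connSetoid hx
  rw [mapGenus] at hgenus
  have hgenus' : (2 * Nat.card (Quotient (connSetoid P.rot P.rev)) + Nat.card G.Dart : ℚ) ≤
      cycleCount P.rot + cycleCount P.rev + cycleCount (P.rot * P.rev) := by
    exact_mod_cast sub_nonpos.1 hgenus
  have hcard' : (Nat.card {y : G.Dart // P.rev y = y} + 1 : ℚ) ≤
      Nat.card (Quotient (connSetoid P.rot P.rev)) := by exact_mod_cast hcard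
  linarith

end SimpleGraph.PlanarSubmap

/-! ### Degeneracy and greedy DP-colouring -/

namespace SimpleGraph

open Equiv.Perm

variable {V : Type*} {G : SimpleGraph V}

/-- Every nonempty set of vertices contains a vertex with at most two neighbours in the set. -/
theorem IsPlanar.exists_card_neighbors_le_two [Finite V] (hG : G.IsPlanar) (hc : G.NoCycles3678)
    {U : Set V} (hU : U.Nonempty) : ∃ v ∈ U, {w ∈ U | G.Adj v w}.ncard ≤ 2 := by
  classical
  have := Fintype.ofFinite V
  by_contra! hdeg
  -- Deleting all edges not inside `U` leaves the subgraph induced by `U`.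
  obtain ⟨P, hP⟩ := hG.exists_planarSubmap
    (Finset.univ.filter fun e : Sym2 V => ¬ ∀ v ∈ e, v ∈ U)
  have halive : ∀ x : G.Dart, P.rev x ≠ x ↔ x.fst ∈ U ∧ x.snd ∈ U := by
    intro x
    rw [ne_eq, hP]
    simp [Dart.edge]
  have hnbr : ∀ x : G.Dart, P.rev x ≠ x → P.rot (P.rot x) ≠ x := by
    intro x hx h2
    have hsub : {w ∈ U | G.Adj x.fst w} ⊆ ({x.snd, (P.rot x).snd} : Set V) := by
      rintro w ⟨hw, hadj⟩
      obtain ⟨i, hi⟩ := (P.sameCycle x ⟨(x.fst, w), hadj⟩ hx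
        ((halive _).2 ⟨((halive x).1 hx).1, hw⟩) rfl).exists_nat_pow_eq
      have hcyc : ∀ i : ℕ, (P.rot ^ i) x = x ∨ (P.rot ^ i) x = P.rot x := by
        intro i
        induction i with
        | zero => exact Or.inl rfl
        | succ i ih =>
          rw [pow_succ', mul_apply]
          rcases ih with h | h
          · exact Or.inr (by rw [h])
          · exact Or.inl (by rw [h, h2])
      rcases hcyc i with h | h
      · left
        rw [← h, hi]
      · right
        rw [Set.mem_singleton_iff, ← h, hi]
    have := Set.ncard_le_ncard hsub (Set.toFinite _)
    have := Set.ncard_insert_le x.snd {(P.rot x).snd}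
    rw [Set.ncard_singleton] at this
    have := hdeg x.fst ((halive x).1 hx).1
    omega
  obtain ⟨v, hv⟩ := hU
  obtain ⟨w, hw, hadj⟩ : {w ∈ U | G.Adj v w}.Nonempty := by
    rw [← Set.ncard_pos]
    have := hdeg v hv
    omega
  refine PlanarSubmap.not_minDegreeThree hc (P := P) (x := ⟨(v, w), hadj⟩)
    ((halive _).2 ⟨hv, hw⟩) fun x hx => ⟨fun h => hnbr x hx (by rw [h, h]), hnbr x hx⟩

namespace MatchingAssignment

variable {L : V → Set ℕ} (A : MatchingAssignment G L)

theorem hasColoring_of_forall_not_rel [Finite V] (f : ∀ u, L u)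
    (hf : ∀ u v, G.Adj u v → ¬ A.rel u v (f u) (f v)) : A.HasColoring := by
  classical
  have := Fintype.ofFinite V
  refine ⟨Finset.univ.image fun u => ⟨u, f u⟩, ?_, ?_⟩
  · intro x hx y hy _ hadj
    simp only [Finset.coe_image, Finset.coe_univ, Set.image_univ, Set.mem_range] at hx hy
    obtain ⟨u, rfl⟩ := hx
    obtain ⟨v, rfl⟩ := hy
    rcases hadj with ⟨h, hne⟩ | ⟨h, hr⟩
    · obtain rfl : u = v := h
      exact hne rfl
    · exact hf u v h hr
  · rw [Finset.card_image_of_injective _ fun u v h => congrArg Sigma.fst h, Finset.card_univ,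
      Nat.card_eq_fintype_card]

/-- Greedy colouring of one further vertex with few coloured neighbours. -/
theorem exists_color {k : ℕ} {v : V} (hL : Set.Icc 1 k ⊆ L v) (f : ∀ u, L u) {N : Set V}
    (hN : N.Finite) (hcard : N.ncard < k) (hadj : ∀ u ∈ N, G.Adj u v) :
    ∃ c : L v, ∀ u ∈ N, ¬ A.rel u v (f u) c := by
  classical
  by_contra! hcon
  have hc : ∀ c : Set.Icc 1 k, ∃ u ∈ N, A.rel u v (f u) ⟨c, hL c.2⟩ := fun c => hcon _
  -- Each coloured neighbour blocks at most one colour, so `k` blocked colours need `k` distinct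
  -- neighbours.
  choose g hg hrel using hc
  have hinj : Function.Injective g := by
    intro c d hcd
    have hd := hrel d
    rw [← hcd] at hd
    exact Subtype.ext (Subtype.mk.inj (A.unique _ _ (hadj _ (hg c)) _ _ _ (hrel c) hd))
  have hle : Nat.card (Set.Icc 1 k) ≤ Nat.card N := by
    have := hN.to_subtype
    exact Nat.card_le_card_of_injective (fun c => (⟨g c, hg c⟩ : N))
      fun c d h => hinj (congrArg Subtype.val h)
  rw [Nat.card_coe_set_eq, Nat.card_coe_set_eq, Set.ncard_eq_toFinset_card'] at hle
  simp at hle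
  omega

end MatchingAssignment

/-- A finite graph in which every nonempty set of vertices contains a vertex with fewer than `k`
neighbours in the set is DP-`k`-colourable. -/
theorem isDPColorable_of_degenerate [Finite V] {k : ℕ}
    (h : ∀ U : Set V, U.Nonempty → ∃ v ∈ U, {w ∈ U | G.Adj v w}.ncard < k) :
    G.IsDPColorable k := by
  classical
  intro L hL A
  have key : ∀ n : ℕ, ∀ U : Set V, U.ncard = n → ∃ f : ∀ u, L u,
      ∀ u ∈ U, ∀ v ∈ U, G.Adj u v → ¬ A.rel u v (f u) (f v) := by
    intro n
    induction n with
    | zero =>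
      intro U hU
      rw [Set.ncard_eq_zero] at hU
      -- The colouring is a total function, so colours are needed outside `U` too; degeneracy of the
      -- whole vertex set forces `0 < k`.
      have hne : ∀ u, Nonempty (L u) := by
        intro u
        obtain ⟨w, -, hw⟩ := h Set.univ ⟨u, trivial⟩
        exact ⟨⟨1, hL u ⟨le_rfl, by omega⟩⟩⟩
      exact ⟨fun u => (hne u).some, by simp [hU]⟩
    | succ n ih =>
      intro U hU
      obtain ⟨v, hv, hdeg⟩ := h U ((Set.ncard_pos).1 (by omega))
      obtain ⟨f, hf⟩ := ih (U \ {v}) (by rw [Set.ncard_sdiff_singleton_of_mem hv]; omega)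
      obtain ⟨c, hc⟩ := A.exists_color (hL v) f (Set.toFinite {w ∈ U | G.Adj v w}) hdeg
        fun u hu => hu.2.symm
      refine ⟨Function.update f v c, fun u hu w hw huw hr => ?_⟩
      by_cases huv : u = v
      · subst huv
        have hwu : w ≠ u := huw.ne.symm
        rw [Function.update_self, Function.update_of_ne hwu] at hr
        exact hc w ⟨hw, huw⟩ (A.symm _ _ huw _ _ hr)
      · rw [Function.update_of_ne huv] at hr
        by_cases hwv : w = v
        · subst hwv
          rw [Function.update_self] at hr
          exact hc u ⟨hu, huw.symm⟩ hr
        · rw [Function.update_of_ne hwv] at hr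
          exact hf u ⟨hu, huv⟩ w ⟨hw, hwv⟩ huw hr
  obtain ⟨f, hf⟩ := key _ Set.univ rfl
  exact A.hasColoring_of_forall_not_rel f fun u v => hf u trivial v trivial

end SimpleGraph

theorem theorem3p1 {V : Type*} [Finite V] (G : SimpleGraph V) (hplanar : G.IsPlanar)
    (hcycles : ∀ (v : V) (p : G.Walk v v), p.IsCycle →
      p.length ≠ 3 ∧ p.length ≠ 6 ∧ p.length ≠ 7 ∧ p.length ≠ 8) :
    G.IsDPColorable 3 :=
  SimpleGraph.isDPColorable_of_degenerate fun _ hU => by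
    obtain ⟨v, hv, h⟩ := hplanar.exists_card_neighbors_le_two hcycles hU
    exact ⟨v, hv, Nat.lt_succ_of_le h⟩
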